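/- Fix a smooth affine group scheme $\mathbf G$ over $\mathbb C$. All schemes are schemes over $\mathbb C$. For a scheme $V$ let $\mathrm{Bun}(V)$ be the groupoid of $\mathbf G$-torsors on $V$ (for the flat topology). Let $Y$ be a scheme, and let $T, Z\subset Y$ be closed subschemes. The *affinized formal completion* $\widehat Z^{\mathrm{aff}}$ is the functor sending a morphism $U=\operatorname{Spec}R\to Y$ with $R$ Noetherian to $\operatorname{Spec}\widehat R_J$, where $J\subset R$ is the ideal of $Z\times_Y U$ and $\widehat R_J$ is the $J$-adic completion; $Y\setminus T$ is identified with the functor $U\mapsto U\times_Y(Y\setminus T)$, and $(Y\setminus T)\cap\widehat Z^{\mathrm{aff}}$ with $U\mapsto (U\times_Y(Y\setminus T))\times_U\operatorname{Spec}\widehat R_J$. For such a functor $\mathfrak F$ and a Noetherian affine scheme $S$, put $\underline{\mathsf{Bun}}_{\mathfrak F}(S)=\operatorname{holim}\mathrm{Bun}(\mathfrak F(U))$ over all $U=\operatorname{Spec}R\to S\times Y$ with $R$ Noetherian, and let $\underline{\mathsf{Bun}}_Y$ be the case $\mathfrak F(U)=U$. Let $\underline{\mathsf{Gr}}(Y;T,Z)(S)$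 be the groupoid of triples $(\mathcal E,\varphi,\psi)$, where $\mathcal E\in\underline{\mathsf{Bun}}_Y(S)$, and $\varphi$, $\psi$ are trivializations of the restrictions of $\mathcal E$ to $Y\setminus T$ and to $\widehat Z^{\mathrm{aff}}$, whose restrictions to $(Y\setminus T)\cap\widehat Z^{\mathrm{aff}}$ are equal; morphisms are the morphisms $\mathcal E\to\mathcal E'$ compatible with the trivializations. This is functorial in $S$. Put $\mathrm{Gr}(Y;T,Z)=\underline{\mathsf{Gr}}(Y;T,Z)(\operatorname{Spec}\mathbb C)$. (1) Let $Y$ be locally Noetherian and let $T_0\subset T_1\subset Y$ be closed subschemes. The canonical closed immersions $T_{1,\mathrm{red}}\hookrightarrow T_1$ and $T_{0,\mathrm{red}}\hookrightarrow T_0$ induce, by restricting trivializations along $Y\setminus T_{1,\mathrm{red}}=Y\setminus T_1$ and $\widehat{T_{0,\mathrm{red}}}^{\mathrm{aff}}\to\widehat{T_0}^{\mathrm{aff}}$, a 1-isomorphism of stacks $\varphi\colon\underline{\mathsf{Gr}}(Y;T_1,T_0)\to\underline{\mathsf{Gr}}(Y;T_{1,\mathrm{red}},T_{0,\mathrm{red}})$,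 that is, a morphism, natural in $S$, which is an equivalence of groupoids for every Noetherian affine $S$. (2) In particular, let $X$ be a smooth projective complex surface, $S$ a Noetherian affine scheme, and let $(D,Z)$ be a flag on $X\times S/S$: $D\subset X\times S$ is a relative effective Cartier divisor over $S$, $Z\subset D$ is a closed subscheme, flat over $S$ with fibres empty or of dimension $0$. Then the closed immersions $D_{\mathrm{red}}\hookrightarrow D$ and $Z_{\mathrm{red}}\hookrightarrow Z$ induce an isomorphism $\varphi_{(D,Z)}\colon\underline{\mathsf{Gr}}(X\times S;D,Z)\to\underline{\mathsf{Gr}}(X\times S;D_{\mathrm{red}},Z_{\mathrm{red}})$, both as stacks and on the associated presheaves of sets of isomorphism classes, and hence a bijection $\mathrm{Gr}(X\times S;D,Z)\to\mathrm{Gr}(X\times S;D_{\mathrm{red}},Z_{\mathrm{red}})$ of sets of isomorphism classes of global sections. (3) If $(D,Z)$ and $(D',Z')$ are two flags on $X\times S/S$ with $D_{\mathrm{red}}=D'_{\mathrm{red}}$ and $Z_{\mathrm{red}}=Z'_{\mathrm{red}}$, then there is a canonical isomorphism $\underline{\mathsf{Gr}}(X\times S;D,Z)\to\underline{\mathsf{Gr}}(X\times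 S;D',Z')$, namely the unique one whose composite with $\varphi_{(D',Z')}$ is $\varphi_{(D,Z)}$, both as functors to groupoids and as functors to sets (isomorphism classes), and hence a canonical bijection $\mathrm{Gr}(X\times S;D,Z)\to\mathrm{Gr}(X\times S;D',Z')$ on isomorphism classes of global sections. -/

import Mathlib

open CategoryTheory Limits MonoidalCategory CartesianMonoidalCategory AlgebraicGeometry

noncomputable section
namespace FlagGr

/-- Schemes over `ℂ`. -/
abbrev SchC : Type 1 := Over (Spec (CommRingCat.of ℂ))

/-- `Spec A` as a `ℂ`-scheme. -/
abbrev specAlg (A : Type) [CommRing A] [Algebra ℂ A] : SchC :=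
  Over.mk (Spec.map (CommRingCat.ofHom (algebraMap ℂ A)))

/-- The morphism `Spec B ⟶ Spec A` of `ℂ`-schemes given by a homomorphism `A → B`. -/
def specAlgMap {A B : Type} [CommRing A] [Algebra ℂ A] [CommRing B] [Algebra ℂ B]
    (f : A →ₐ[ℂ] B) : specAlg B ⟶ specAlg A :=
  Over.homMk (Spec.map (CommRingCat.ofHom f.toRingHom)) (by
    dsimp
    rw [← Spec.map_comp, ← CommRingCat.ofHom_comp]
    congr 2
    exact f.comp_algebraMap)

lemma specAlgMap_id (A : Type) [CommRing A] [Algebra ℂ A] :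
    specAlgMap (AlgHom.id ℂ A) = 𝟙 (specAlg A) := by
  ext1
  exact Spec.map_id _

lemma specAlgMap_comp {A B C : Type} [CommRing A] [Algebra ℂ A] [CommRing B] [Algebra ℂ B]
    [CommRing C] [Algebra ℂ C] (f : A →ₐ[ℂ] B) (g : B →ₐ[ℂ] C) :
    specAlgMap (g.comp f) = specAlgMap g ≫ specAlgMap f := by
  ext1
  exact Spec.map_comp (CommRingCat.ofHom f.toRingHom) (CommRingCat.ofHom g.toRingHom)

/-- Noetherian commutative `ℂ`-algebras. -/
structure NoethAlg : Type 1 where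
  carrier : Type
  [commRing : CommRing carrier]
  [algebra : Algebra ℂ carrier]
  [noeth : IsNoetherianRing carrier]

namespace NoethAlg
instance : CoeSort NoethAlg Type := ⟨carrier⟩
attribute [instance] commRing algebra noeth

/-- The category of Noetherian `ℂ`-algebras; its opposite is the category of Noetherian affine
`ℂ`-schemes. -/
instance : Category NoethAlg where
  Hom A B := A →ₐ[ℂ] B
  id A := AlgHom.id ℂ A
  comp f g := AlgHom.comp g f

end NoethAlg

/-- The category of Noetherian affine schemes over `Y`: objects are morphisms `Spec R ⟶ Y` of
`ℂ`-schemes with `R` Noetherian. -/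
structure AffOver (Y : SchC) : Type 1 where
  ring : NoethAlg
  hom : specAlg ring ⟶ Y

instance (Y : SchC) : Category (AffOver Y) where
  Hom U V := {f : V.ring →ₐ[ℂ] U.ring // specAlgMap f ≫ V.hom = U.hom}
  id U := ⟨AlgHom.id ℂ U.ring, by rw [specAlgMap_id, Category.id_comp]⟩
  comp f g := ⟨f.1.comp g.1, by rw [specAlgMap_comp, Category.assoc, g.2, f.2]⟩

/-- The inclusion `U ↦ U`. -/
def affIncl (Y : SchC) : AffOver Y ⥤ SchC where
  obj U := specAlg U.ring
  map h := specAlgMap h.1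
  map_id _ := specAlgMap_id _
  map_comp _ _ := specAlgMap_comp _ _

/-- Fiber functors over `Y`: functors `𝔉` from Noetherian affine schemes over `Y` to `ℂ`-schemes, with a
natural transformation `𝔉(U) ⟶ U`. -/
abbrev FiberFunctor (Y : SchC) := Over (affIncl Y)

/-- The structure maps `U ⟶ Y`. -/
def affHom (Y : SchC) : affIncl Y ⟶ (Functor.const (AffOver Y)).obj Y where
  app U := U.hom
  naturality _ _ h := h.2.trans (Category.comp_id _).symm

/-- The fiber functor `U ↦ U ×_Y V` of a scheme `V` over `Y`. -/
def FiberFunctor.ofScheme {Y V : SchC} (j : V ⟶ Y) : FiberFunctor Y :=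
  Over.mk (pullback.fst (affHom Y) ((Functor.const (AffOver Y)).map j))

/-- The morphism `U ×_Y V ⟶ U ×_Y V'` induced by a morphism `V ⟶ V'` over `Y`. -/
def FiberFunctor.ofSchemeMap {Y V V' : SchC} (j : V ⟶ Y) (j' : V' ⟶ Y) (k : V ⟶ V') (w : k ≫ j' = j) :
    FiberFunctor.ofScheme j ⟶ FiberFunctor.ofScheme j' :=
  Over.homMk (pullback.map _ _ _ _ (𝟙 _) ((Functor.const (AffOver Y)).map k) (𝟙 _)
    (by simp) (by rw [← Functor.map_comp, w, Category.comp_id]))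
    ((pullback.lift_fst _ _ _).trans (Category.comp_id _))

/-- The open complement of a closed subscheme. Closed subschemes are given by their
quasi-coherent ideal sheaves; `T ⊆ T'` as subschemes means `T' ≤ T` as ideal sheaves, and the
reduced subscheme of `T` is `T.radical`. -/
abbrev complOpen {Y : Scheme.{0}} (T : Y.IdealSheafData) : Y.Opens := T.support.compl

/-- The open immersion `Y ∖ T ⟶ Y`. -/
def complIncl {Y : SchC} (T : Y.left.IdealSheafData) :
    (Over.mk ((complOpen T).ι ≫ Y.hom) : SchC) ⟶ Y :=
  Over.homMk (complOpen T).ι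

/-- The fiber functor `U ↦ U ×_Y (Y ∖ T)`. -/
def FiberFunctor.compl {Y : SchC} (T : Y.left.IdealSheafData) : FiberFunctor Y := FiberFunctor.ofScheme (complIncl T)

/-- The inclusion `Y ∖ T' ⟶ Y ∖ T` when `|T| ⊆ |T'|`, as fiber functors. -/
def FiberFunctor.complMap {Y : SchC} {T T' : Y.left.IdealSheafData} (h : T.support ≤ T'.support) :
    FiberFunctor.compl T' ⟶ FiberFunctor.compl T :=
  FiberFunctor.ofSchemeMap _ _
    (Over.homMk (Y.left.homOfLE (show complOpen T' ≤ complOpen T from Set.compl_subset_compl.mpr h)) (by simp))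
    (by ext1; simp [complIncl])

/-- For `y : Spec R ⟶ Y` and a closed subscheme `Z` of `Y`, the ideal of `R` defining the closed
subscheme `Z ×_Y Spec R` of `Spec R`. -/
def idealOn {Y : SchC} (Z : Y.left.IdealSheafData) {R : Type} [CommRing R] [Algebra ℂ R]
    (y : specAlg R ⟶ Y) : Ideal R :=
  ((Z.comap y.left).ideal ⟨⊤, isAffineOpen_top (Spec (CommRingCat.of R))⟩).comap
    (Scheme.ΓSpecIso (CommRingCat.of R)).inv.hom

section Completion
variable {R R' R'' : Type} [CommRing R] [Algebra ℂ R] [CommRing R'] [Algebra ℂ R'] [CommRing R'']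
  [Algebra ℂ R'']

lemma idealOn_mono {Y : SchC} {Z Z' : Y.left.IdealSheafData} (hZ : Z ≤ Z') (y : specAlg R ⟶ Y) :
    idealOn Z y ≤ idealOn Z' y :=
  Ideal.comap_mono (Scheme.IdealSheafData.comap_mono _ hZ _)

lemma idealOn_le {Y : SchC} (Z : Y.left.IdealSheafData) (y : specAlg R ⟶ Y) (f : R →ₐ[ℂ] R') :
    idealOn Z y ≤ (idealOn Z (specAlgMap f ≫ y)).comap f := by
  let g : CommRingCat.of R ⟶ CommRingCat.of R' := CommRingCat.ofHom f.toRingHom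
  let I : (Spec (CommRingCat.of R)).IdealSheafData := Z.comap y.left
  have h1 : I ≤ (I.comap (Spec.map g)).map (Spec.map g) :=
    Scheme.IdealSheafData.le_map_comap _ _
  have h0 : Z.comap (specAlgMap f ≫ y).left = I.comap (Spec.map g) :=
    Scheme.IdealSheafData.comap_comp _ _ _
  intro r hr
  have h2 := h1 ⟨⊤, isAffineOpen_top (Spec (CommRingCat.of R))⟩ hr
  rw [Scheme.IdealSheafData.ideal_map_of_isAffineHom] at h2
  have h3 : (Spec.map g).app ⊤ ((Scheme.ΓSpecIso _).inv r) = (Scheme.ΓSpecIso _).inv (g r) :=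
    (congr($(Scheme.ΓSpecIso_inv_naturality g) r)).symm
  have h4 : (Spec.map g).app ⊤ ((Scheme.ΓSpecIso _).inv r) ∈
    (I.comap (Spec.map g)).ideal ⟨⊤, isAffineOpen_top (Spec (CommRingCat.of R'))⟩ := h2
  rw [h3, ← h0] at h4
  exact h4

lemma pow_le_comap {J : Ideal R} {J' : Ideal R'} (f : R →ₐ[ℂ] R') (h : J ≤ J'.comap f) (n : ℕ) :
    J ^ n ≤ (J' ^ n).comap f :=
  (Ideal.pow_right_mono h n).trans (Ideal.le_comap_pow _ n)

lemma completionMap_compat {J : Ideal R} {J' : Ideal R'} (f : R →ₐ[ℂ] R') (h : J ≤ J'.comap f)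
    {m n : ℕ} (hle : m ≤ n) :
    (Ideal.Quotient.factorₐ ℂ (Ideal.pow_le_pow_right hle)).comp
        ((Ideal.quotientMapₐ (J' ^ n) f (pow_le_comap f h n)).comp
          ((AdicCompletion.evalₐ J n).restrictScalars ℂ)) =
      (Ideal.quotientMapₐ (J' ^ m) f (pow_le_comap f h m)).comp
        ((AdicCompletion.evalₐ J m).restrictScalars ℂ) := by
  ext x
  obtain ⟨x, rfl⟩ := AdicCompletion.mk_surjective J R x
  have hx := AdicCompletion.Ideal.mk_eq_mk J hle x
  have := congrArg (Ideal.quotientMapₐ (J' ^ m) f (pow_le_comap f h m)) hx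
  simpa using this

/-- The map `R̂_J → R̂'_{J'}` of adic completions induced by `f : R → R'` with `f(J) ⊆ J'`. -/
def completionMap {J : Ideal R} {J' : Ideal R'} (f : R →ₐ[ℂ] R') (h : J ≤ J'.comap f) :
    AdicCompletion J R →ₐ[ℂ] AdicCompletion J' R' :=
  AdicCompletion.liftAlgHom J'
    (fun n => (Ideal.quotientMapₐ (J' ^ n) f (pow_le_comap f h n)).comp
      ((AdicCompletion.evalₐ J n).restrictScalars ℂ))
    (completionMap_compat f h)

lemma evalₐ_completionMap {J : Ideal R} {J' : Ideal R'} (f : R →ₐ[ℂ] R') (h : J ≤ J'.comap f)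
    (n : ℕ) (x : AdicCompletion J R) :
    AdicCompletion.evalₐ J' n (completionMap f h x) =
      Ideal.quotientMapₐ (J' ^ n) f (pow_le_comap f h n) (AdicCompletion.evalₐ J n x) :=
  AdicCompletion.evalₐ_liftAlgHom J' _ (completionMap_compat f h) n x

lemma le_comap_id {J J' : Ideal R} (h : J ≤ J') : J ≤ J'.comap (AlgHom.id ℂ R) :=
  fun _ hx => h hx

lemma completionMap_id (J : Ideal R) (h : J ≤ J.comap (AlgHom.id ℂ R)) :
    completionMap (AlgHom.id ℂ R) h = AlgHom.id ℂ (AdicCompletion J R) := by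
  ext1 x
  refine AdicCompletion.ext_evalₐ fun n => ?_
  rw [evalₐ_completionMap]
  obtain ⟨y, hy⟩ := Ideal.Quotient.mk_surjective (AdicCompletion.evalₐ J n x)
  rw [AlgHom.id_apply, ← hy]
  rfl

lemma completionMap_comp {J : Ideal R} {J' : Ideal R'} {J'' : Ideal R''} (f : R →ₐ[ℂ] R')
    (g : R' →ₐ[ℂ] R'') (h : J ≤ J'.comap f) (h' : J' ≤ J''.comap g)
    (h'' : J ≤ J''.comap (g.comp f)) :
    completionMap (g.comp f) h'' = (completionMap g h').comp (completionMap f h) := by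
  ext1 x
  refine AdicCompletion.ext_evalₐ fun n => ?_
  rw [AlgHom.comp_apply, evalₐ_completionMap, evalₐ_completionMap, evalₐ_completionMap]
  obtain ⟨y, hy⟩ := Ideal.Quotient.mk_surjective (AdicCompletion.evalₐ J n x)
  rw [← hy]
  rfl

/-- The canonical map `R → R̂_J`. -/
def completionOf (J : Ideal R) : R →ₐ[ℂ] AdicCompletion J R :=
  (Algebra.ofId R (AdicCompletion J R)).restrictScalars ℂ

lemma completionMap_of {J : Ideal R} {J' : Ideal R'} (f : R →ₐ[ℂ] R') (h : J ≤ J'.comap f) :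
    (completionMap f h).comp (completionOf J) = (completionOf J').comp f := by
  ext1 x
  refine AdicCompletion.ext_evalₐ fun n => ?_
  rw [AlgHom.comp_apply, evalₐ_completionMap]
  simp [completionOf, Algebra.ofId_apply]

end Completion

/-! ### The affinized formal completion -/

lemma idealOn_le' {Y : SchC} (Z : Y.left.IdealSheafData) {U V : AffOver Y} (h : U ⟶ V) :
    idealOn Z V.hom ≤ (idealOn Z U.hom).comap h.1 := by
  have := idealOn_le Z V.hom h.1
  rwa [h.2] at this

/-- `U = Spec R ↦ Spec (R̂_J)`, where `J` is the ideal of `Z ×_Y U` in `U`. -/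
def completionFunctor {Y : SchC} (Z : Y.left.IdealSheafData) : AffOver Y ⥤ SchC where
  obj U := specAlg (AdicCompletion (idealOn Z U.hom) U.ring)
  map {U V} h := specAlgMap (completionMap h.1 (idealOn_le' Z h))
  map_id U := by
    rw [← specAlgMap_id]
    exact congrArg _ (completionMap_id _ _)
  map_comp h k := by
    rw [← specAlgMap_comp]
    exact congrArg _ (completionMap_comp _ _ _ _ _)

/-- The canonical morphisms `Spec (R̂_J) ⟶ Spec R`. -/
def completionProj {Y : SchC} (Z : Y.left.IdealSheafData) : completionFunctor Z ⟶ affIncl Y where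
  app U := specAlgMap (completionOf (idealOn Z U.hom))
  naturality _ _ h :=
    (specAlgMap_comp (completionOf _) (completionMap h.1 (idealOn_le' Z h))).symm.trans
      ((congrArg specAlgMap (completionMap_of h.1 (idealOn_le' Z h))).trans
        (specAlgMap_comp h.1 (completionOf _)))

/-- For closed subschemes `Z' ⊆ Z` (that is, `Z ≤ Z'` as ideals), the morphisms between the
`Spec` of the completions induced by the identity of `R`. -/
def completionInclApp {Y : SchC} {Z Z' : Y.left.IdealSheafData} (hZ : Z ≤ Z') :
    completionFunctor Z' ⟶ completionFunctor Z where
  app U := specAlgMap (completionMap (AlgHom.id ℂ U.ring)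
        (le_comap_id (idealOn_mono hZ U.hom)))
  naturality {U V} h := by
    have h1 := (idealOn_le' Z h).trans (Ideal.comap_mono (f := h.1) (idealOn_mono hZ U.hom))
    have e1 := completionMap_comp (AlgHom.id ℂ V.ring) h.1
      (le_comap_id (idealOn_mono hZ V.hom)) (idealOn_le' Z' h) h1
    have e2 := completionMap_comp h.1 (AlgHom.id ℂ U.ring) (idealOn_le' Z h)
      (le_comap_id (idealOn_mono hZ U.hom)) h1
    exact (specAlgMap_comp _ _).symm.trans
      ((congrArg specAlgMap (e1.symm.trans e2)).trans (specAlgMap_comp _ _))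

lemma completionIncl_proj {Y : SchC} {Z Z' : Y.left.IdealSheafData} (hZ : Z ≤ Z') :
    completionInclApp hZ ≫ completionProj Z = completionProj Z' := by
  ext U : 2
  have e := completionMap_of (AlgHom.id ℂ U.ring) (le_comap_id (idealOn_mono hZ U.hom))
  exact (specAlgMap_comp (completionOf (idealOn Z U.hom)) (completionMap (AlgHom.id ℂ U.ring)
    (le_comap_id (idealOn_mono hZ U.hom)))).symm.trans (congrArg specAlgMap e)

/-- The affinized formal completion of `Y` along `Z`, as a fiber functor. -/
def FiberFunctor.completion {Y : SchC} (Z : Y.left.IdealSheafData) : FiberFunctor Y :=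
  Over.mk (completionProj Z)

/-- The morphism of affinized formal completions induced by a closed immersion `Z' ⟶ Z`. -/
def FiberFunctor.completionIncl {Y : SchC} {Z Z' : Y.left.IdealSheafData} (hZ : Z ≤ Z') :
    FiberFunctor.completion Z' ⟶ FiberFunctor.completion Z :=
  Over.homMk (completionInclApp hZ) (completionIncl_proj hZ)

/-! ### `G`-bundles -/

variable (G : SchC) [GrpObj G]

/-- `G`-torsors (for the flat topology): a scheme `tot` over `base` with an action of `G` over `base`,
such that `tot ⟶ base` is flat, locally of finite presentation and surjective and
`(g, x) ↦ (g x, x)` is an isomorphism from `G × tot` to `tot ×_base tot`. -/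
structure Torsor where
  base : SchC
  tot : SchC
  proj : tot ⟶ base
  act : G ⊗ tot ⟶ tot
  one_act : (λ_ tot).inv ≫ (MonObj.one (X := G) ▷ tot) ≫ act = 𝟙 tot
  mul_act : (MonObj.mul (X := G) ▷ tot) ≫ act = (α_ G G tot).hom ≫ (G ◁ act) ≫ act
  flat : Flat proj.left
  locallyOfFinitePresentation : LocallyOfFinitePresentation proj.left
  surjective : Surjective proj.left
  isPullback : IsPullback act (snd G tot) proj proj

variable {G}

/-- Morphisms of torsors over varying bases: equivariant maps whose square over the bases is
cartesian. They are the isomorphisms `P ≅ f^* Q` for `f` the morphism of bases. -/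
@[ext]
structure Torsor.Hom (P Q : Torsor G) where
  base : P.base ⟶ Q.base
  tot : P.tot ⟶ Q.tot
  equivariant : P.act ≫ tot = (G ◁ tot) ≫ Q.act
  isPullback : IsPullback tot P.proj Q.proj base

instance : Category (Torsor G) where
  Hom := Torsor.Hom
  id P := ⟨𝟙 _, 𝟙 _, by simp, IsPullback.of_horiz_isIso ⟨by simp⟩⟩
  comp f g := ⟨f.base ≫ g.base, f.tot ≫ g.tot,
    by rw [reassoc_of% f.equivariant, g.equivariant, whiskerLeft_comp, Category.assoc],
    f.isPullback.paste_horiz g.isPullback⟩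
  id_comp _ := Torsor.Hom.ext (Category.id_comp _) (Category.id_comp _)
  comp_id _ := Torsor.Hom.ext (Category.comp_id _) (Category.comp_id _)
  assoc _ _ _ := Torsor.Hom.ext (Category.assoc _ _ _) (Category.assoc _ _ _)

variable (G)

/-- The fibration of the category of torsors (the stack `BG`) over schemes; its fibre over `V` is the
groupoid `Bun(V)`. -/
def baseFunctor : Torsor G ⥤ SchC where
  obj P := P.base
  map f := f.base



lemma triv_one_act (W : SchC) : (λ_ (G ⊗ W)).inv ≫ (MonObj.one (X := G) ▷ (G ⊗ W)) ≫
    (α_ G G W).inv ≫ (MonObj.mul (X := G) ▷ W) = 𝟙 _ := by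
  have := congrArg (fun k => k ▷ W) (MonObj.one_mul G)
  rw [whiskerRight_tensor] 
  simp only [comp_whiskerRight] at this
  simp [this]

lemma triv_mul_act (W : SchC) : (MonObj.mul (X := G) ▷ (G ⊗ W)) ≫
    (α_ G G W).inv ≫ (MonObj.mul (X := G) ▷ W) = (α_ G G (G ⊗ W)).hom ≫
      (G ◁ ((α_ G G W).inv ≫ (MonObj.mul (X := G) ▷ W))) ≫
      (α_ G G W).inv ≫ (MonObj.mul (X := G) ▷ W) := by
  have := congrArg (fun k => k ▷ W) (MonObj.mul_assoc G)
  simp only [comp_whiskerRight] at this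
  simp [this]

lemma triv_surj (W : SchC) : Surjective (snd G W).left := by
  have h : (lift (toUnit W ≫ MonObj.one (X := G)) (𝟙 W)).left ≫ (snd G W).left = 𝟙 W.left :=
    congrArg Over.Hom.left (lift_snd _ _)
  have : Surjective ((lift (toUnit W ≫ MonObj.one (X := G)) (𝟙 W)).left ≫ (snd G W).left) := by
    rw [h]; infer_instance
  exact Surjective.of_comp (lift (toUnit W ≫ MonObj.one (X := G)) (𝟙 W)).left (snd G W).left

open MonObj GrpObj in
lemma triv_act_fst {W V : SchC} (m : V ⟶ G ⊗ (G ⊗ W)) :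
    (m ≫ ((α_ G G W).inv ≫ (MonObj.mul (X := G) ▷ W))) ≫ fst G W =
      (m ≫ fst G (G ⊗ W)) * ((m ≫ snd G (G ⊗ W)) ≫ fst G W) := by
  rw [Hom.mul_def]
  simp only [Category.assoc, whiskerRight_fst]
  rw [← Category.assoc (α_ G G W).inv, ← Category.assoc m]
  congr 1
  ext1 <;> simp

open MonObj GrpObj in
lemma triv_isPullback (W : SchC) : IsPullback ((α_ G G W).inv ≫ (MonObj.mul (X := G) ▷ W))
    (snd G (G ⊗ W)) (snd G W) (snd G W) := by
  refine ⟨⟨by simp⟩, ⟨PullbackCone.IsLimit.mk _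
    (fun s => lift ((s.fst ≫ fst G W) * (s.snd ≫ fst G W)⁻¹) s.snd) (fun s => ?_) (fun s => ?_)
    (fun s m h1 h2 => ?_)⟩⟩
  · ext1
    · rw [triv_act_fst]
      simp
    · have := s.condition
      simp [← this]
  · simp
  · ext1
    · have := triv_act_fst G m
      rw [h1, h2] at this
      simp [this]
    · simpa using h2

variable [Smooth G.hom]

/-- The trivial `G`-torsor `G × W` over `W`. -/
def trivTorsor (W : SchC) : Torsor G where
  base := W
  tot := G ⊗ W
  proj := snd G W
  act := (α_ G G W).inv ≫ (MonObj.mul (X := G) ▷ W)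
  one_act := triv_one_act G W
  mul_act := triv_mul_act G W
  flat := by
    change Flat (pullback.snd G.hom W.hom)
    infer_instance
  locallyOfFinitePresentation := by
    change LocallyOfFinitePresentation (pullback.snd G.hom W.hom)
    infer_instance
  surjective := triv_surj G W
  isPullback := triv_isPullback G W

lemma trivMap_isPullback (G : SchC) {W W' : SchC} (f : W ⟶ W') :
    IsPullback (G ◁ f) (snd G W) (snd G W') f := by
  refine ⟨⟨by simp⟩, ⟨PullbackCone.IsLimit.mk _
    (fun s => lift (s.fst ≫ fst G W') s.snd) (fun s => ?_) (fun s => ?_) (fun s m h1 h2 => ?_)⟩⟩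
  · have := s.condition
    ext1 <;> simp [this]
  · simp
  · ext1
    · simp [← h1]
    · simpa using h2

/-- The trivial torsor on every scheme, with the canonical morphisms between them. -/
def triv : SchC ⥤ Torsor G where
  obj W := trivTorsor G W
  map {W W'} f := 
    { base := f
      tot := G ◁ f
      equivariant := by simp [trivTorsor, ← whisker_exchange]
      isPullback := trivMap_isPullback G f }
  map_id W := Torsor.Hom.ext rfl (whiskerLeft_id _ _)
  map_comp f g := Torsor.Hom.ext rfl (whiskerLeft_comp _ _ _)


/-! ### Bundles on diagrams of schemes -/

section Bundles
universe v u
variable {C : Type u} [Category.{v} C]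

/-- The homotopy limit of the groupoids `Bun(Φ c)`, `c : C`, for a diagram of schemes `Φ`: a
compatible family of torsors `E c` on `Φ c`, that is, a lift of `Φ` to the category of torsors. -/
structure Bun (Φ : C ⥤ SchC) where
  P : C ⥤ Torsor G
  iso : P ⋙ baseFunctor G ≅ Φ

variable {G}

/-- Morphisms in the homotopy limit: compatible families of morphisms of torsors over the
identities. -/
@[ext]
structure Bun.Hom {Φ : C ⥤ SchC} (E E' : Bun G Φ) where
  hom : E.P ⟶ E'.P
  w : Functor.whiskerRight hom (baseFunctor G) ≫ E'.iso.hom = E.iso.hom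

instance (Φ : C ⥤ SchC) : Category (Bun G Φ) where
  Hom := Bun.Hom
  id E := ⟨𝟙 _, by simp⟩
  comp f g := ⟨f.hom ≫ g.hom, by rw [Functor.whiskerRight_comp, Category.assoc, g.w, f.w]⟩
  id_comp _ := Bun.Hom.ext (Category.id_comp _)
  comp_id _ := Bun.Hom.ext (Category.comp_id _)
  assoc _ _ _ := Bun.Hom.ext (Category.assoc _ _ _)

/-- A morphism of torsors over an isomorphism is invertible. -/
def Torsor.inv {P Q : Torsor G} (f : P ⟶ Q) [IsIso f.base] : Q ⟶ P :=
  have : IsIso f.tot := f.isPullback.isIso_fst_of_isIso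
  { base := CategoryTheory.inv f.base
    tot := CategoryTheory.inv f.tot
    equivariant := by
      rw [IsIso.comp_inv_eq, Category.assoc, f.equivariant, ← whiskerLeft_comp_assoc]
      simp
    isPullback := IsPullback.of_horiz_isIso ⟨by
      rw [IsIso.eq_comp_inv, Category.assoc, IsIso.inv_comp_eq, f.isPullback.w]⟩ }

lemma Torsor.isIso {P Q : Torsor G} (f : P ⟶ Q) (h : IsIso f.base) : IsIso f :=
  have : IsIso f.tot := f.isPullback.isIso_fst_of_isIso
  ⟨Torsor.inv f, Torsor.Hom.ext (IsIso.hom_inv_id f.base) (IsIso.hom_inv_id f.tot),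
    Torsor.Hom.ext (IsIso.inv_hom_id f.base) (IsIso.inv_hom_id f.tot)⟩

lemma Bun.isIso_hom {Φ : C ⥤ SchC} {E E' : Bun G Φ} (f : E ⟶ E') : IsIso f.hom := by
  have h0 : Functor.whiskerRight f.hom (baseFunctor G) = E.iso.hom ≫ E'.iso.inv := by
    rw [← f.w, Category.assoc, Iso.hom_inv_id, Category.comp_id]
  have h1 : IsIso (Functor.whiskerRight f.hom (baseFunctor G)) := by
    rw [h0]
    infer_instance
  have h : ∀ c, IsIso (f.hom.app c) := fun c =>
    Torsor.isIso _ (inferInstanceAs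
      (IsIso ((Functor.whiskerRight f.hom (baseFunctor G)).app c)))
  exact NatIso.isIso_of_isIso_app _

/-- Restriction of a bundle along a functor of index categories. -/
def Bun.restr {C' : Type*} [Category C'] {Φ : C ⥤ SchC} (κ : C' ⥤ C) (E : Bun G Φ) :
    Bun G (κ ⋙ Φ) where
  P := κ ⋙ E.P
  iso := Functor.isoWhiskerLeft κ E.iso

variable (G) in
/-- For `α : Φ' ⟶ Φ` and a bundle `E` on `Φ`, an isomorphism of the trivial bundle on `Φ'` with the
restriction `α^* E`, given by compatible (automatically cartesian) morphisms of torsors over `α`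
from the trivial bundle to `E`. -/
structure Bun.Triv {Φ Φ' : C ⥤ SchC} (α : Φ' ⟶ Φ) (E : Bun G Φ) where
  hom : Φ' ⋙ triv G ⟶ E.P
  w : Functor.whiskerRight hom (baseFunctor G) ≫ E.iso.hom = α

end Bundles

/-- Noetherian affine schemes over `S × Y`, for `S = Spec A`: a Noetherian affine scheme `Spec R` over `Y`
with a homomorphism `A → R`. -/
structure Test (Y : SchC) (A : NoethAlg) : Type 1 where
  toY : AffOver Y
  str : A ⟶ toY.ring

namespace Test
variable {Y : SchC} {A A' A'' : NoethAlg}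

instance : Category (Test Y A) where
  Hom U V := {h : U.toY ⟶ V.toY // h.1.comp V.str = U.str}
  id U := ⟨𝟙 U.toY, rfl⟩
  comp {U V W} f g := ⟨f.1 ≫ g.1,
    (congrArg (AlgHom.comp f.1.1) g.2).trans f.2⟩

variable (Y A) in
/-- Composition with the projection `S × Y ⟶ Y`. -/
def forget : Test Y A ⥤ AffOver Y where
  obj U := U.toY
  map h := h.1

variable (Y) in
/-- Composition with `S' × Y ⟶ S × Y` for a morphism `S' ⟶ S`. -/
def map (f : A ⟶ A') : Test Y A' ⥤ Test Y A where
  obj U := ⟨U.toY, f ≫ U.str⟩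
  map {U V} h := ⟨h.1, congrArg (fun k : A' ⟶ U.toY.ring => f ≫ k) h.2⟩

end Test

/-! ### Grassmannians -/

section Gr
variable {Y : SchC} (F₁ F₂ : FiberFunctor Y)

section Site
universe v' u'
variable {C : Type u'} [Category.{v'} C] (π : C ⥤ AffOver Y)

/-- Triples `(E, φ, ψ)`: a `G`-bundle `E` on the schemes `U` of the diagram `π` (over `Y`), with
trivializations `φ` over `F₁` and `ψ` over `F₂` that agree over the intersection
`F₁ ∩ F₂ = F₁ ×_Y F₂`. -/
structure GrObj where
  E : Bun G (π ⋙ affIncl Y)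
  φ : Bun.Triv G (Functor.whiskerLeft π F₁.hom) E
  ψ : Bun.Triv G (Functor.whiskerLeft π F₂.hom) E
  agree : Functor.whiskerLeft π
      (Functor.whiskerRight (pullback.fst F₁.hom F₂.hom) (triv G)) ≫ φ.hom =
    Functor.whiskerLeft π
      (Functor.whiskerRight (pullback.snd F₁.hom F₂.hom) (triv G)) ≫ ψ.hom

variable {G F₁ F₂ π}

/-- Morphisms of triples: morphisms of bundles compatible with the trivializations. -/
@[ext]
structure GrObj.Hom (p q : GrObj G F₁ F₂ π) where
  hom : p.E ⟶ q.E
  compatφ : p.φ.hom ≫ hom.hom = q.φ.hom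
  compatψ : p.ψ.hom ≫ hom.hom = q.ψ.hom

instance : Category (GrObj G F₁ F₂ π) where
  Hom := GrObj.Hom
  id p := ⟨𝟙 p.E, Category.comp_id _, Category.comp_id _⟩
  comp f g := ⟨f.hom ≫ g.hom,
    (Category.assoc _ _ _).symm.trans ((congrArg (fun k => k ≫ g.hom.hom) f.compatφ).trans g.compatφ),
    (Category.assoc _ _ _).symm.trans ((congrArg (fun k => k ≫ g.hom.hom) f.compatψ).trans g.compatψ)⟩
  id_comp _ := GrObj.Hom.ext (Category.id_comp _)
  comp_id _ := GrObj.Hom.ext (Category.comp_id _)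
  assoc _ _ _ := GrObj.Hom.ext (Category.assoc _ _ _)

/-- Morphisms of bundles are invertible. -/
def Bun.inv {C : Type*} [Category C] {Φ : C ⥤ SchC} {E E' : Bun G Φ} (f : E ⟶ E') : E' ⟶ E :=
  have := Bun.isIso_hom f
  ⟨CategoryTheory.inv f.hom, by
    have h : Functor.whiskerRight (CategoryTheory.inv f.hom) (baseFunctor G) ≫
        Functor.whiskerRight f.hom (baseFunctor G) = 𝟙 _ := by
      rw [← Functor.whiskerRight_comp, IsIso.inv_hom_id, Functor.whiskerRight_id']
    rw [← f.w, reassoc_of% h]⟩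

instance : Groupoid (GrObj G F₁ F₂ π) where
  inv f :=
    have := Bun.isIso_hom f.hom
    ⟨Bun.inv f.hom, (IsIso.comp_inv_eq _).mpr f.compatφ.symm,
      (IsIso.comp_inv_eq _).mpr f.compatψ.symm⟩
  inv_comp f :=
    have := Bun.isIso_hom f.hom
    GrObj.Hom.ext (Bun.Hom.ext (IsIso.inv_hom_id f.hom.hom))
  comp_inv f :=
    have := Bun.isIso_hom f.hom
    GrObj.Hom.ext (Bun.Hom.ext (IsIso.hom_inv_id f.hom.hom))

/-- Restriction of triples along a functor of index categories. -/
def GrObj.pull {C' : Type u'} [Category.{v'} C'] (κ : C' ⥤ C) :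
    GrObj G F₁ F₂ π ⥤ GrObj G F₁ F₂ (κ ⋙ π) where
  obj p :=
    { E := p.E.restr κ
      φ := ⟨Functor.whiskerLeft κ p.φ.hom, congrArg (Functor.whiskerLeft κ) p.φ.w⟩
      ψ := ⟨Functor.whiskerLeft κ p.ψ.hom, congrArg (Functor.whiskerLeft κ) p.ψ.w⟩
      agree := congrArg (Functor.whiskerLeft κ) p.agree }
  map α :=
    { hom := ⟨Functor.whiskerLeft κ α.hom.hom, congrArg (Functor.whiskerLeft κ) α.hom.w⟩
      compatφ := congrArg (Functor.whiskerLeft κ) α.compatφ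
      compatψ := congrArg (Functor.whiskerLeft κ) α.compatψ }

lemma GrObj.pull_id :
    GrObj.pull (G := G) (F₁ := F₁) (F₂ := F₂) (π := π) (𝟭 C) = 𝟭 _ := rfl

lemma GrObj.pull_comp {C' C'' : Type u'} [Category.{v'} C'] [Category.{v'} C''] (κ : C' ⥤ C)
    (κ' : C'' ⥤ C') :
    GrObj.pull (G := G) (F₁ := F₁) (F₂ := F₂) (π := π) (κ' ⋙ κ) =
      GrObj.pull κ ⋙ GrObj.pull κ' := rfl

/-- Restriction of the trivializations of a triple along morphisms of fiber functors. -/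
def GrObj.restrict {F₁' F₂' : FiberFunctor Y} (a : F₁' ⟶ F₁) (b : F₂' ⟶ F₂) :
    GrObj G F₁ F₂ π ⥤ GrObj G F₁' F₂' π where
  obj p :=
    { E := p.E
      φ := ⟨Functor.whiskerLeft π (Functor.whiskerRight a.left (triv G)) ≫ p.φ.hom,
        by 
          rw [Functor.whiskerRight_comp, Category.assoc, p.φ.w]
          exact congrArg (Functor.whiskerLeft π) (Over.w a)⟩
      ψ := ⟨Functor.whiskerLeft π (Functor.whiskerRight b.left (triv G)) ≫ p.ψ.hom,
        by
          rw [Functor.whiskerRight_comp, Category.assoc, p.ψ.w]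
          exact congrArg (Functor.whiskerLeft π) (Over.w b)⟩
      agree := by
        let k := pullback.map F₁'.hom F₂'.hom F₁.hom F₂.hom a.left b.left (𝟙 _)
          (by simp) (by simp)
        have h := congrArg (fun t => Functor.whiskerLeft π
          (Functor.whiskerRight k (triv G)) ≫ t) p.agree
        have h1 : k ≫ pullback.fst F₁.hom F₂.hom = pullback.fst F₁'.hom F₂'.hom ≫ a.left :=
          pullback.lift_fst _ _ _
        have h2 : k ≫ pullback.snd F₁.hom F₂.hom = pullback.snd F₁'.hom F₂'.hom ≫ b.left :=
          pullback.lift_snd _ _ _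

        rw [← Functor.whiskerLeft_comp_assoc, ← Functor.whiskerLeft_comp_assoc,
          ← Functor.whiskerRight_comp, ← Functor.whiskerRight_comp, h1, h2] at h
        rw [← Functor.whiskerLeft_comp_assoc, ← Functor.whiskerLeft_comp_assoc,
          ← Functor.whiskerRight_comp, ← Functor.whiskerRight_comp, h] }
  map α :=
    { hom := α.hom
      compatφ := (Category.assoc _ _ _).trans (congrArg _ α.compatφ)
      compatψ := (Category.assoc _ _ _).trans (congrArg _ α.compatψ) }

lemma GrObj.restrict_pull {F₁' F₂' : FiberFunctor Y} (a : F₁' ⟶ F₁) (b : F₂' ⟶ F₂)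
    {C' : Type u'} [Category.{v'} C'] (κ : C' ⥤ C) :
    (GrObj.pull κ ⋙ GrObj.restrict a b : GrObj G F₁ F₂ π ⥤ GrObj G F₁' F₂' (κ ⋙ π)) =
      GrObj.restrict a b ⋙ GrObj.pull κ := rfl

end Site

/-- Pullback of triples from `S × Y` to `S' × Y`, for `S = Spec A` and `S' = Spec A'`. -/
def GrObj.baseChange {A A' : NoethAlg} (f : A ⟶ A') :
    GrObj G F₁ F₂ (Test.forget Y A) ⥤ GrObj G F₁ F₂ (Test.forget Y A') :=
  GrObj.pull (Test.map Y f)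

/-- The prestack `S ↦ {(E, φ, ψ)}` on Noetherian affine `ℂ`-schemes, with `E` a `G`-bundle on `S × Y`, `φ`
and `ψ` trivializations of its restrictions to `F₁` and `F₂`, equal over `F₁ ∩ F₂`. -/
def GrOf : NoethAlg ⥤ Grpd.{1, 1} where
  obj A := Grpd.of (GrObj G F₁ F₂ (Test.forget Y A))
  map f := GrObj.baseChange G F₁ F₂ f
  map_id A := GrObj.pull_id
  map_comp f g := GrObj.pull_comp (Test.map Y f) (Test.map Y g)

variable {G F₁ F₂} in
/-- Restriction of trivializations, as a morphism of prestacks. -/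
def GrOf.restrict {F₁' F₂' : FiberFunctor Y} (a : F₁' ⟶ F₁) (b : F₂' ⟶ F₂) : GrOf G F₁ F₂ ⟶ GrOf G F₁' F₂' where
  app A := GrObj.restrict (π := Test.forget Y A) a b
  naturality A A' f := GrObj.restrict_pull (π := Test.forget Y A) a b (Test.map Y f)

end Gr


/-- The Grassmannian `Gr(Y; T, Z)` of a scheme `Y` relative to closed subschemes `T`, `Z`, as a functor on
Noetherian affine `ℂ`-schemes with values in groupoids: bundles on `S × Y` with trivializations on `Y ∖ T` and
on the affinized formal completion along `Z`, agreeing on the intersection. -/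
def Gr (Y : SchC) (T Z : Y.left.IdealSheafData) : NoethAlg ⥤ Grpd.{1, 1} :=
  GrOf G (FiberFunctor.compl T) (FiberFunctor.completion Z)

/-- The morphism `Gr(Y; T, Z) ⟶ Gr(Y; T_red, Z_red)` induced by the closed immersions `T_red ⟶ T` and
`Z_red ⟶ Z`: trivializations are restricted along the induced maps `Y ∖ T_red ⟶ Y ∖ T` and from the
completion along `Z_red` to the completion along `Z`. The reduced subschemes may be given as
subschemes `T'`, `Z'` equal to them. -/
def reductionMap {Y : SchC} (T Z : Y.left.IdealSheafData) {T' Z' : Y.left.IdealSheafData}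
    (hT : T.radical = T') (hZ : Z.radical = Z') : Gr G Y T Z ⟶ Gr G Y T' Z' :=
  GrOf.restrict (FiberFunctor.complMap (by rw [← hT, Scheme.IdealSheafData.support_radical]))
    (FiberFunctor.completionIncl (hZ ▸ Z.le_radical))

/-- The set of isomorphism classes of a groupoid (its underlying set, when it is discrete). -/
def π₀ : Grpd.{1, 1} ⥤ Type 1 := Grpd.forgetToCat ⋙ isomorphismClasses

/-- `(D, Z)` is a family of flags on `X` relative to `S = Spec A`: `D` is a relative effective Cartier
divisor on `X × S / S`, `Z` is a closed subscheme of `X × S`, flat over `S` with fibres of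
dimension `≤ 0` (possibly empty), and `Z ⊆ D`. -/
structure IsFlag (X : SchC) (A : NoethAlg) (D Z : (X ⊗ specAlg A).left.IdealSheafData) : Prop where
  le : D ≤ Z
  flat_D : Flat (D.subschemeι ≫ (snd X (specAlg A)).left)
  cartier_D : ∀ x : (X ⊗ specAlg A).left, ∃ V : (X ⊗ specAlg A).left.affineOpens, x ∈ V.1 ∧
    ∃ f ∈ nonZeroDivisors Γ((X ⊗ specAlg A).left, V.1), D.ideal V = Ideal.span {f}
  flat_Z : Flat (Z.subschemeι ≫ (snd X (specAlg A)).left)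
  dim_Z : ∀ s : (specAlg A).left,
    topologicalKrullDim ((Z.subschemeι ≫ (snd X (specAlg A)).left).fiber s) ≤ 0

/-- The Noetherian algebra `ℂ`; `Spec ℂ` is the final test scheme. -/
abbrev algC : NoethAlg := ⟨ℂ⟩

end FlagGr
end

open FlagGr

/-!
The theorem is a consequence of two independent invariance statements.

* The open subscheme `Y ∖ T` depends only on the underlying set of `T`, so the inclusion
  `Y ∖ T_red ⟶ Y ∖ T` is an isomorphism (`FiberFunctor.isIso_complMap`).
* For `Spec R ⟶ Y` with `R` Noetherian, let `J` and `J'` be the ideals of the pullbacks of `Z` and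
  `Z_red`. They have the same underlying closed set, so `J ≤ J' ≤ √J` (`idealOn_radical_le`). As `J'`
  is finitely generated, `J' ^ m ≤ J` for some `m`, so the two adic topologies coincide, and
  `R̂_J → R̂_{J'}` is an isomorphism (`isIso_specAlgMap_completionMap`). Hence so is the morphism of
  affinized formal completions (`FiberFunctor.isIso_completionIncl`).

Restriction of trivializations is strictly functorial in the two fiber functors
(`GrObj.restrict_id`, `GrObj.restrict_comp`), so restriction along isomorphisms is an isomorphism of
functors to groupoids (`GrOf.isIso_restrict`). The reduction map is thus itself an isomorphism
(`isIso_reductionMap`), not merely an objectwise equivalence. Applying `π₀` gives the statements on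
isomorphism classes, and the comparison between two flags with the same reduction is one
reduction map followed by the inverse of the other.
-/

noncomputable section

namespace FlagGr

section Completion

variable {R : Type} [CommRing R]

lemma pow_mul_le_pow {J J' : Ideal R} {m : ℕ} (hm : J' ^ m ≤ J) (k : ℕ) : J' ^ (m * k) ≤ J ^ k :=
  (pow_mul J' m k).trans_le (Ideal.pow_right_mono hm k)

variable [Algebra ℂ R]

lemma completionOfPowLE_compat {J J' : Ideal R} {m : ℕ} (hm : J' ^ m ≤ J) {k l : ℕ}
    (hkl : k ≤ l) :
    (Ideal.Quotient.factorₐ ℂ (Ideal.pow_le_pow_right hkl)).comp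
        ((Ideal.Quotient.factorₐ ℂ (pow_mul_le_pow hm l)).comp
          ((AdicCompletion.evalₐ J' (m * l)).restrictScalars ℂ)) =
      (Ideal.Quotient.factorₐ ℂ (pow_mul_le_pow hm k)).comp
        ((AdicCompletion.evalₐ J' (m * k)).restrictScalars ℂ) := by
  ext x
  obtain ⟨x, rfl⟩ := AdicCompletion.mk_surjective J' R x
  have hx := AdicCompletion.Ideal.mk_eq_mk J' (Nat.mul_le_mul_left m hkl) x
  have := congrArg (Ideal.Quotient.factor (pow_mul_le_pow hm k)) hx
  simpa using this

/-- If `J' ^ m ≤ J`, the map `R̂_{J'} → R̂_J` whose component at level `k` is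
`R̂_{J'} → R ⧸ J' ^ (m * k) → R ⧸ J ^ k`. -/
def completionOfPowLE {J J' : Ideal R} {m : ℕ} (hm : J' ^ m ≤ J) :
    AdicCompletion J' R →ₐ[ℂ] AdicCompletion J R :=
  AdicCompletion.liftAlgHom J
    (fun k => (Ideal.Quotient.factorₐ ℂ (pow_mul_le_pow hm k)).comp
      ((AdicCompletion.evalₐ J' (m * k)).restrictScalars ℂ))
    (completionOfPowLE_compat hm)

lemma evalₐ_completionOfPowLE {J J' : Ideal R} {m : ℕ} (hm : J' ^ m ≤ J) (k : ℕ)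
    (x : AdicCompletion J' R) :
    AdicCompletion.evalₐ J k (completionOfPowLE hm x) =
      Ideal.Quotient.factor (pow_mul_le_pow hm k) (AdicCompletion.evalₐ J' (m * k) x) :=
  AdicCompletion.evalₐ_liftAlgHom J _ (completionOfPowLE_compat hm) k x

/-- At level `k`, the composite is the transition map `R ⧸ J' ^ (m * k) → R ⧸ J' ^ k`; it makes
sense because `m ≥ 1`. -/
lemma completionMap_comp_completionOfPowLE {J J' : Ideal R} {m : ℕ} (hm : J' ^ m ≤ J)
    (hm0 : 1 ≤ m) (h : J ≤ J'.comap (AlgHom.id ℂ R)) :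
    (completionMap (AlgHom.id ℂ R) h).comp (completionOfPowLE hm) = AlgHom.id ℂ _ := by
  ext1 x
  refine AdicCompletion.ext_evalₐ fun k => ?_
  rw [AlgHom.comp_apply, evalₐ_completionMap, evalₐ_completionOfPowLE]
  obtain ⟨x, rfl⟩ := AdicCompletion.mk_surjective J' R x
  have hx := AdicCompletion.Ideal.mk_eq_mk J' (Nat.le_mul_of_pos_left k hm0) x
  simpa using hx

lemma completionOfPowLE_comp_completionMap {J J' : Ideal R} {m : ℕ} (hm : J' ^ m ≤ J)
    (hm0 : 1 ≤ m) (h : J ≤ J'.comap (AlgHom.id ℂ R)) :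
    (completionOfPowLE hm).comp (completionMap (AlgHom.id ℂ R) h) = AlgHom.id ℂ _ := by
  ext1 x
  refine AdicCompletion.ext_evalₐ fun k => ?_
  rw [AlgHom.comp_apply, evalₐ_completionOfPowLE, evalₐ_completionMap]
  obtain ⟨x, rfl⟩ := AdicCompletion.mk_surjective J R x
  have hx := AdicCompletion.Ideal.mk_eq_mk J (Nat.le_mul_of_pos_left k hm0) x
  simpa using hx

/-- Over a Noetherian ring, the completion depends only on the radical of the ideal. -/
lemma isIso_specAlgMap_completionMap [IsNoetherianRing R] {J J' : Ideal R}
    (h : J ≤ J'.comap (AlgHom.id ℂ R)) (hJ : J' ≤ J.radical) :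
    IsIso (specAlgMap (completionMap (AlgHom.id ℂ R) h)) := by
  obtain ⟨n, hn⟩ := Ideal.exists_pow_le_of_le_radical_of_fg hJ (IsNoetherian.noetherian J')
  -- The exponent is raised by one, so that it is positive even when `J = ⊤`.
  have hm : J' ^ (n + 1) ≤ J := (Ideal.pow_le_pow_right n.le_succ).trans hn
  refine ⟨specAlgMap (completionOfPowLE hm), ?_, ?_⟩
  · rw [← specAlgMap_comp, completionMap_comp_completionOfPowLE hm n.succ_pos, specAlgMap_id]
  · rw [← specAlgMap_comp, completionOfPowLE_comp_completionMap hm n.succ_pos, specAlgMap_id]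

end Completion

/-- Pulling `Z` and `Z_red` back to `Spec R` gives ideals with the same radical, since both closed
subschemes have the same underlying set. -/
lemma idealOn_radical_le {Y : SchC} (Z : Y.left.IdealSheafData) {R : Type} [CommRing R]
    [Algebra ℂ R] (y : specAlg R ⟶ Y) : idealOn Z.radical y ≤ (idealOn Z y).radical := by
  have h : Z.radical.comap y.left ≤ (Z.comap y.left).radical := by
    rw [← (Z.comap y.left).vanishingIdeal_support, Scheme.IdealSheafData.support_comap,
      ← Z.support_radical, ← Scheme.IdealSheafData.support_comap,
      Scheme.IdealSheafData.vanishingIdeal_support]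
    exact Scheme.IdealSheafData.le_radical _
  unfold idealOn
  rw [← Ideal.comap_radical]
  exact Ideal.comap_mono (h _)

/-- Being an isomorphism is checked on Noetherian affine schemes over `Y`, the only ones on which
fiber functors are evaluated. -/
lemma FiberFunctor.isIso_completionIncl {Y : SchC} {Z Z' : Y.left.IdealSheafData}
    (hZ : Z ≤ Z') (hr : Z' ≤ Z.radical) : IsIso (FiberFunctor.completionIncl hZ) := by
  have h (U : AffOver Y) : IsIso ((completionInclApp hZ).app U) :=
    isIso_specAlgMap_completionMap _ ((idealOn_mono hr U.hom).trans (idealOn_radical_le Z U.hom))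
  have : IsIso (FiberFunctor.completionIncl hZ).left :=
    NatIso.isIso_of_isIso_app (completionInclApp hZ)
  exact @isIso_of_reflects_iso _ _ _ _ _ _ _ (Over.forget _) this _

lemma FiberFunctor.isIso_ofSchemeMap {Y V V' : SchC} (j : V ⟶ Y) (j' : V' ⟶ Y) (k : V ⟶ V')
    (w : k ≫ j' = j) [IsIso k] : IsIso (FiberFunctor.ofSchemeMap j j' k w) := by
  have : IsIso (FiberFunctor.ofSchemeMap j j' k w).left :=
    inferInstanceAs (IsIso (pullback.map (affHom Y) ((Functor.const (AffOver Y)).map j) (affHom Y)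
      ((Functor.const (AffOver Y)).map j') (𝟙 _) ((Functor.const (AffOver Y)).map k) (𝟙 _)
      (by simp) (by rw [← Functor.map_comp, w, Category.comp_id])))
  exact @isIso_of_reflects_iso _ _ _ _ _ _ _ (Over.forget _) this _

lemma FiberFunctor.isIso_complMap {Y : SchC} {T T' : Y.left.IdealSheafData}
    (h : T.support = T'.support) : IsIso (FiberFunctor.complMap h.le) := by
  have e : complOpen T' = complOpen T := by rw [complOpen, complOpen, h]
  have h1 : IsIso (Y.left.homOfLE e.le) := inferInstanceAs (IsIso (Y.left.isoOfEq e).hom)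
  have : IsIso (Over.homMk (U := Over.mk ((complOpen T').ι ≫ Y.hom))
      (V := Over.mk ((complOpen T).ι ≫ Y.hom)) (Y.left.homOfLE e.le) (by simp)) :=
    @isIso_of_reflects_iso _ _ _ _ _ _ _ (Over.forget _) h1 _
  exact FiberFunctor.isIso_ofSchemeMap ..

section Restrict

universe v u

variable {G : SchC} [GrpObj G] [Smooth G.hom] {Y : SchC} {F₁ F₂ F₁' F₂' F₁'' F₂'' : FiberFunctor Y}

section Site

variable {C : Type u} [Category.{v} C] {π : C ⥤ AffOver Y}

/-- Two triples with the same bundle and the same trivializations are equal. -/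
lemma GrObj.eq_of_bundle_eq {p q : GrObj G F₁ F₂ π} (hE : p.E = q.E) (hφ : p.φ.hom ≍ q.φ.hom)
    (hψ : p.ψ.hom ≍ q.ψ.hom) : p = q := by
  obtain ⟨E, ⟨φ, _⟩, ⟨ψ, _⟩, _⟩ := p
  obtain ⟨E', ⟨φ', _⟩, ⟨ψ', _⟩, _⟩ := q
  obtain rfl : E = E' := hE
  obtain rfl : φ = φ' := eq_of_heq hφ
  obtain rfl : ψ = ψ' := eq_of_heq hψ
  rfl

/-- Only the bundle component has to be compared, the compatibilities being propositions. -/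
lemma GrObj.hom_heq {p q p' q' : GrObj G F₁ F₂ π} (hp : p = p') (hq : q = q') {f : p ⟶ q}
    {g : p' ⟶ q'} (h : f.hom ≍ g.hom) : f ≍ g := by
  subst hp hq
  exact heq_of_eq (GrObj.Hom.ext (eq_of_heq h))

/-! The underlying data of a restricted triple are stated as separate (heterogeneous) equations, and
equalities of composite restrictions are chained through them: unfolding two nested restrictions at
once is very expensive for the kernel. -/

lemma GrObj.restrict_obj_E (a : F₁' ⟶ F₁) (b : F₂' ⟶ F₂) (p : GrObj G F₁ F₂ π) :
    ((GrObj.restrict a b).obj p).E = p.E :=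
  rfl

lemma GrObj.restrict_obj_φ (a : F₁' ⟶ F₁) (b : F₂' ⟶ F₂) (p : GrObj G F₁ F₂ π) :
    ((GrObj.restrict a b).obj p).φ.hom ≍
      Functor.whiskerLeft π (Functor.whiskerRight a.left (triv G)) ≫ p.φ.hom :=
  HEq.rfl

lemma GrObj.restrict_obj_ψ (a : F₁' ⟶ F₁) (b : F₂' ⟶ F₂) (p : GrObj G F₁ F₂ π) :
    ((GrObj.restrict a b).obj p).ψ.hom ≍
      Functor.whiskerLeft π (Functor.whiskerRight b.left (triv G)) ≫ p.ψ.hom :=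
  HEq.rfl

lemma GrObj.restrict_map_hom (a : F₁' ⟶ F₁) (b : F₂' ⟶ F₂) {p q : GrObj G F₁ F₂ π} (f : p ⟶ q) :
    ((GrObj.restrict a b).map f).hom ≍ f.hom :=
  HEq.rfl

lemma whiskerLeft_map_id_left_comp {F : FiberFunctor Y} {P : C ⥤ Torsor G}
    (k : π ⋙ F.left ⋙ triv G ⟶ P) :
    Functor.whiskerLeft π (Functor.whiskerRight (𝟙 F : F ⟶ F).left (triv G)) ≫ k = k := by
  rw [Over.id_left, Functor.whiskerRight_id', Functor.whiskerLeft_id']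
  exact Category.id_comp k

lemma whiskerLeft_map_comp_left_comp {F F' F'' : FiberFunctor Y} (a' : F'' ⟶ F') (a : F' ⟶ F)
    {P : C ⥤ Torsor G} (k : π ⋙ F.left ⋙ triv G ⟶ P) :
    Functor.whiskerLeft π (Functor.whiskerRight (a' ≫ a).left (triv G)) ≫ k =
      Functor.whiskerLeft π (Functor.whiskerRight a'.left (triv G)) ≫
        Functor.whiskerLeft π (Functor.whiskerRight a.left (triv G)) ≫ k := by
  rw [Over.comp_left, Functor.whiskerRight_comp, Functor.whiskerLeft_comp, Category.assoc]

lemma GrObj.restrict_id_obj (p : GrObj G F₁ F₂ π) :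
    (GrObj.restrict (𝟙 F₁) (𝟙 F₂)).obj p = p :=
  GrObj.eq_of_bundle_eq (restrict_obj_E _ _ p)
    ((restrict_obj_φ _ _ p).trans (heq_of_eq (whiskerLeft_map_id_left_comp p.φ.hom)))
    ((restrict_obj_ψ _ _ p).trans (heq_of_eq (whiskerLeft_map_id_left_comp p.ψ.hom)))

lemma GrObj.restrict_id : (GrObj.restrict (𝟙 F₁) (𝟙 F₂) : GrObj G F₁ F₂ π ⥤ _) = 𝟭 _ :=
  Functor.hext restrict_id_obj fun p q _ =>
    GrObj.hom_heq (restrict_id_obj p) (restrict_id_obj q) (restrict_map_hom _ _ _)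

lemma GrObj.restrict_comp_obj (a : F₁' ⟶ F₁) (b : F₂' ⟶ F₂) (a' : F₁'' ⟶ F₁')
    (b' : F₂'' ⟶ F₂') (p : GrObj G F₁ F₂ π) :
    (GrObj.restrict (a' ≫ a) (b' ≫ b)).obj p =
      (GrObj.restrict a' b').obj ((GrObj.restrict a b).obj p) :=
  GrObj.eq_of_bundle_eq
    ((restrict_obj_E (a' ≫ a) (b' ≫ b) p).trans
      ((restrict_obj_E a' b' ((GrObj.restrict a b).obj p)).trans (restrict_obj_E a b p)).symm)
    ((restrict_obj_φ (a' ≫ a) (b' ≫ b) p).trans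
      ((heq_of_eq (whiskerLeft_map_comp_left_comp a' a p.φ.hom)).trans
        (restrict_obj_φ a' b' ((GrObj.restrict a b).obj p)).symm))
    ((restrict_obj_ψ (a' ≫ a) (b' ≫ b) p).trans
      ((heq_of_eq (whiskerLeft_map_comp_left_comp b' b p.ψ.hom)).trans
        (restrict_obj_ψ a' b' ((GrObj.restrict a b).obj p)).symm))

lemma GrObj.restrict_comp (a : F₁' ⟶ F₁) (b : F₂' ⟶ F₂) (a' : F₁'' ⟶ F₁') (b' : F₂'' ⟶ F₂') :
    (GrObj.restrict (a' ≫ a) (b' ≫ b) : GrObj G F₁ F₂ π ⥤ _) =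
      GrObj.restrict a b ⋙ GrObj.restrict a' b' :=
  Functor.hext (restrict_comp_obj a b a' b') fun p q f =>
    GrObj.hom_heq (restrict_comp_obj a b a' b' p) (restrict_comp_obj a b a' b' q)
      ((restrict_map_hom (a' ≫ a) (b' ≫ b) f).trans
        ((restrict_map_hom a' b' ((GrObj.restrict a b).map f)).trans
          (restrict_map_hom a b f)).symm)

end Site

lemma GrOf.isIso_restrict (a : F₁' ⟶ F₁) (b : F₂' ⟶ F₂) [IsIso a] [IsIso b] :
    IsIso (GrOf.restrict (G := G) a b) := by
  refine ⟨GrOf.restrict (inv a) (inv b), ?_, ?_⟩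
  · ext A : 2
    refine (GrObj.restrict_comp _ _ _ _).symm.trans ?_
    rw [IsIso.inv_hom_id, IsIso.inv_hom_id]
    exact GrObj.restrict_id
  · ext A : 2
    refine (GrObj.restrict_comp _ _ _ _).symm.trans ?_
    rw [IsIso.hom_inv_id, IsIso.hom_inv_id]
    exact GrObj.restrict_id

end Restrict

variable (G : SchC) [GrpObj G] [Smooth G.hom]

/-- The reduction map is an isomorphism of functors to groupoids, not only an objectwise
equivalence. -/
lemma isIso_reductionMap {Y : SchC} (T Z : Y.left.IdealSheafData) {T' Z' : Y.left.IdealSheafData}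
    (hT : T.radical = T') (hZ : Z.radical = Z') : IsIso (reductionMap G T Z hT hZ) := by
  subst hT hZ
  have : IsIso (FiberFunctor.complMap (Y := Y) (T := T) (T' := T.radical)
      (by rw [Scheme.IdealSheafData.support_radical])) :=
    FiberFunctor.isIso_complMap T.support_radical.symm
  have := FiberFunctor.isIso_completionIncl Z.le_radical le_rfl
  exact GrOf.isIso_restrict _ _

lemma isEquivalence_of_isIso_grpd {P Q : Grpd.{1, 1}} (f : P ⟶ Q) [IsIso f] :
    f.IsEquivalence :=
  (Cat.equivOfIso (Grpd.forgetToCat.mapIso (asIso f))).isEquivalence_functor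

end FlagGr

end

theorem proposition6 (G : SchC) [GrpObj G] [IsAffine G.left] [Smooth G.hom] :
    -- the reduction maps are an isomorphism of stacks
    (∀ (Y : SchC) [IsLocallyNoetherian Y.left] (T₁ T₀ : Y.left.IdealSheafData), T₁ ≤ T₀ →
      ∀ B : NoethAlg, ((reductionMap G T₁ T₀ rfl rfl).app B).IsEquivalence) ∧
    -- the case of flags on a surface
    (∀ (X : SchC) [IsProper X.hom] [SmoothOfRelativeDimension 2 X.hom] (A : NoethAlg)
        (D Z : (X ⊗ specAlg A).left.IdealSheafData), IsFlag X A D Z →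
      (∀ B : NoethAlg, ((reductionMap G D Z rfl rfl).app B).IsEquivalence) ∧
      IsIso (Functor.whiskerRight (reductionMap G D Z rfl rfl) π₀) ∧
      Function.Bijective (π₀.map ((reductionMap G D Z rfl rfl).app algC))) ∧
    -- two flags with the same reduced subschemes
    (∀ (X : SchC) [IsProper X.hom] [SmoothOfRelativeDimension 2 X.hom] (A : NoethAlg)
        (D Z D' Z' : (X ⊗ specAlg A).left.IdealSheafData),
        IsFlag X A D Z → IsFlag X A D' Z' →
        ∀ (hD : D.radical = D'.radical) (hZ : Z.radical = Z'.radical),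
      (∃! ρ : Gr G _ D Z ≅ Gr G _ D' Z',
        ρ.hom ≫ reductionMap G D' Z' rfl rfl = reductionMap G D Z hD hZ) ∧
      (∃ σ : Gr G _ D Z ⋙ π₀ ≅ Gr G _ D' Z' ⋙ π₀,
        (σ.hom ≫ Functor.whiskerRight (reductionMap G D' Z' rfl rfl) π₀ =
          Functor.whiskerRight (reductionMap G D Z hD hZ) π₀) ∧
        (∀ σ' : Gr G _ D Z ⋙ π₀ ≅ Gr G _ D' Z' ⋙ π₀,
          σ'.hom ≫ Functor.whiskerRight (reductionMap G D' Z' rfl rfl) π₀ =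
            Functor.whiskerRight (reductionMap G D Z hD hZ) π₀ → σ' = σ) ∧
        Function.Bijective (σ.hom.app algC))) := by
  have iso {Y : SchC} (T Z : Y.left.IdealSheafData) {T' Z' : Y.left.IdealSheafData}
      (hT : T.radical = T') (hZ : Z.radical = Z') := isIso_reductionMap G T Z hT hZ
  have equiv {Y : SchC} (T Z : Y.left.IdealSheafData) (B : NoethAlg) :
      ((reductionMap G T Z rfl rfl).app B).IsEquivalence :=
    have := iso T Z rfl rfl
    isEquivalence_of_isIso_grpd _
  refine ⟨fun Y _ T₁ T₀ _ B => equiv T₁ T₀ B, fun X _ _ A D Z _ => ⟨equiv D Z, ?_, ?_⟩,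
    fun X _ _ A D Z D' Z' _ _ hD hZ => ?_⟩
  · have := iso D Z rfl rfl
    infer_instance
  · have := iso D Z rfl rfl
    exact (isIso_iff_bijective _).mp inferInstance
  · have := iso D Z hD hZ
    have := iso D' Z' rfl rfl
    refine ⟨⟨asIso (reductionMap G D Z hD hZ) ≪≫ (asIso (reductionMap G D' Z' rfl rfl)).symm,
      by simp, fun ρ hρ => ?_⟩,
      asIso (Functor.whiskerRight (reductionMap G D Z hD hZ) π₀) ≪≫
        (asIso (Functor.whiskerRight (reductionMap G D' Z' rfl rfl) π₀)).symm,
      by simp only [Iso.trans_hom, Iso.symm_hom, asIso_hom, asIso_inv, Category.assoc,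
          IsIso.inv_hom_id, Category.comp_id],
      fun σ hσ => ?_, (isIso_iff_bijective _).mp inferInstance⟩
    · ext1
      simp [← hρ]
    · ext1
      simp only [← hσ, Iso.trans_hom, Iso.symm_hom, asIso_hom, asIso_inv, Category.assoc,
        IsIso.hom_inv_id, Category.comp_id]
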